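/- Let $p$ be a prime, let $n\ge 0$, and let $\mathcal{L}_n=(\mathbb{Z}/p\mathbb{Z})^n\wr\mathbb{Z}=\mathcal{A}_n\rtimes\mathbb{Z}$ with $\mathcal{A}_n=\bigoplus_{\mathbb{Z}}(\mathbb{Z}/p\mathbb{Z})^n$, where $1\in\mathbb{Z}$ acts on $\mathcal{A}_n$ by the right shift $x$. Let $R=\mathbb{F}_p[\mathbb{Z}]=\mathbb{F}_p[x,x^{-1}]$ and identify $\mathcal{A}_n$ with $R^n$. The pro-$p$ (respectively profinite) completion of a group $G$ is the projective limit of the discrete groups $G/N$ over the normal subgroups $N$ of index a power of $p$ (respectively of finite index), with its canonical map from $G$. Let $\mathbb{Z}_p$ be the $p$-adic integers, $\hat{\mathbb{Z}}=\varprojlim_{m\ge 1}\mathbb{Z}/m$, and let $\mathbb{F}_p[[\mathbb{Z}_p]]=\varprojlim_m\mathbb{F}_p[\mathbb{Z}/p^m]$ and $\mathbb{F}_p[[\hat{\mathbb{Z}}]]=\varprojlim_{m\ge 1}\mathbb{F}_p[\mathbb{Z}/m]$ with the projective limit topologies. Form $\mathbb{F}_p[[\mathbb{Z}_p]]^n\rtimes\mathbb{Z}_p$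 and $\mathbb{F}_p[[\hat{\mathbb{Z}}]]^n\rtimes\hat{\mathbb{Z}}$ with the product topologies, where $a$ in $\mathbb{Z}_p$ or $\hat{\mathbb{Z}}$ acts on each coordinate by multiplication by the group-like element $[a]$, the compatible family of the basis elements $a \bmod p^m$ or $a\bmod m$. Then there are isomorphisms of topological groups (of topological rings in the statements on $R$), compatible with the canonical maps, as follows. 1. The pro-$p$ completion of $\mathcal{L}_n$ is $\mathbb{F}_p[[\mathbb{Z}_p]]^n\rtimes\mathbb{Z}_p$. Here $\mathbb{Z}_p$ is the pro-$p$ completion of $\mathbb{Z}$, and $\mathbb{F}_p[[\mathbb{Z}_p]]$ is the pro-$p$ completion of the group ring $R$, that is, $\varprojlim R/I$ over the ideals $I$ of finite index such that the image of $\mathbb{Z}$ in $(R/I)^\times$ is a $p$-group. 2. The profinite completion of $\mathcal{L}_n$ is $\mathbb{F}_p[[\hat{\mathbb{Z}}]]^n\rtimes\hat{\mathbb{Z}}$. Here $\hat{\mathbb{Z}}$ is the profinite completion of $\mathbb{Z}$, and $\mathbb{F}_p[[\hat{\mathbb{Z}}]]$ is the profinite completion of the ring $R$, that is, $\varprojlim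 R/I$ over the ideals $I$ of finite index. -/

import Mathlib

namespace LamplighterCompletion

/-! ### The groups `ℒ_n` -/

/-- The base group `⨁_ℤ (ℤ/p)^n`. -/
abbrev Base (p n : ℕ) : Type := ℤ →₀ (Fin n → ZMod p)

/-- `s ∈ ℤ` acts on the base group by the `s`-th power of the right shift by one:
`(x^s w) i = w (i - s)`. -/
noncomputable def shift (p n : ℕ) : Multiplicative ℤ →* MulAut (Multiplicative (Base p n)) where
  toFun s := AddEquiv.toMultiplicative (Finsupp.domCongr (Equiv.addRight s.toAdd))
  map_one' := by
    ext v i j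
    change v (i + -0) j = v i j
    rw [neg_zero, add_zero]
  map_mul' s t := by
    ext v i j
    change v ((Equiv.addRight (s.toAdd + t.toAdd)).symm i) j =
      v ((Equiv.addRight t.toAdd).symm ((Equiv.addRight s.toAdd).symm i)) j
    simp only [Equiv.addRight_symm, Equiv.coe_addRight, neg_add, add_assoc, add_comm (-s.toAdd)]

/-- `ℒ_n = (ℤ/p)^n ≀ ℤ = (⨁_ℤ (ℤ/p)^n) ⋊ ℤ`, with `(v, s)(w, t) = (v + x^s w, s + t)`. -/
abbrev L (p n : ℕ) : Type := Multiplicative (Base p n) ⋊[shift p n] Multiplicative ℤ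

/-! ### Pro-`p` completion of a group -/

/-- The index set of the pro-`p` completion: normal subgroups of index a power of `p`. -/
def PNormal (p : ℕ) (G : Type*) [Group G] : Type _ :=
  {N : Subgroup G // N.Normal ∧ ∃ k : ℕ, N.index = p ^ k}

instance (p : ℕ) (G : Type*) [Group G] (N : PNormal p G) : N.1.Normal := N.2.1

/-- Compatible families in the product of the quotients `G ⧸ N`. -/
def proPSubgroup (p : ℕ) (G : Type*) [Group G] : Subgroup (∀ N : PNormal p G, G ⧸ N.1) where
  carrier := {f | ∀ (N M : PNormal p G) (h : N.1 ≤ M.1),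
    QuotientGroup.map N.1 M.1 (MonoidHom.id G) h (f N) = f M}
  mul_mem' := by
    intro a b ha hb N M h
    simp only [Pi.mul_apply, map_mul, ha N M h, hb N M h]
  one_mem' := by
    intro N M h
    simp only [Pi.one_apply, map_one]
  inv_mem' := by
    intro a ha N M h
    simp only [Pi.inv_apply, map_inv, ha N M h]

/-- The pro-`p` completion of `G`: the projective limit of the quotients `G ⧸ N`, where `N` runs
over the normal subgroups of index a power of `p`. -/
def ProPCompletion (p : ℕ) (G : Type*) [Group G] : Type _ := proPSubgroup p G

instance (p : ℕ) (G : Type*) [Group G] : Group (ProPCompletion p G) :=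
  inferInstanceAs (Group (proPSubgroup p G))

/-- The projective limit topology: induced by the product of the discrete topologies. -/
instance (p : ℕ) (G : Type*) [Group G] : TopologicalSpace (ProPCompletion p G) :=
  TopologicalSpace.induced (fun f : proPSubgroup p G => f.1) (@Pi.topologicalSpace _ _ fun _ => ⊥)

/-- The canonical map from `G` to its pro-`p` completion. -/
def toProPCompletion (p : ℕ) (G : Type*) [Group G] : G →* ProPCompletion p G where
  toFun g := (⟨fun _ => QuotientGroup.mk g, fun _ _ _ => rfl⟩ : proPSubgroup p G)
  map_one' := rfl
  map_mul' _ _ := rfl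

/-! ### Completion of a commutative ring with respect to a family of ideals -/

/-- Compatible families in the product of the quotients `A ⧸ I`, `I ∈ F`. -/
def idealLimit {A : Type*} [CommRing A] (F : Set (Ideal A)) : Subring (∀ I : F, A ⧸ I.1) where
  carrier := {f | ∀ (I J : F) (h : I.1 ≤ J.1), Ideal.Quotient.factor h (f I) = f J}
  mul_mem' := by
    intro a b ha hb I J h
    simp only [Pi.mul_apply, map_mul, ha I J h, hb I J h]
  one_mem' := by
    intro I J h
    simp only [Pi.one_apply, map_one]
  add_mem' := by
    intro a b ha hb I J h
    simp only [Pi.add_apply, map_add, ha I J h, hb I J h]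
  zero_mem' := by
    intro I J h
    simp only [Pi.zero_apply, map_zero]
  neg_mem' := by
    intro a ha I J h
    simp only [Pi.neg_apply, map_neg, ha I J h]

/-- The projective limit of the quotients `A ⧸ I`, `I ∈ F`. -/
def IdealCompletion {A : Type*} [CommRing A] (F : Set (Ideal A)) : Type _ := idealLimit F

instance {A : Type*} [CommRing A] (F : Set (Ideal A)) : CommRing (IdealCompletion F) :=
  inferInstanceAs (CommRing (idealLimit F))

/-- The projective limit topology: induced by the product of the discrete topologies. -/
instance {A : Type*} [CommRing A] (F : Set (Ideal A)) : TopologicalSpace (IdealCompletion F) :=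
  TopologicalSpace.induced (fun f : idealLimit F => f.1) (@Pi.topologicalSpace _ _ fun _ => ⊥)

/-- The canonical map from `A` to its completion. -/
def toIdealCompletion {A : Type*} [CommRing A] (F : Set (Ideal A)) : A →+* IdealCompletion F where
  toFun a := (⟨fun _ => Ideal.Quotient.mk _ a, fun _ _ _ => rfl⟩ : idealLimit F)
  map_one' := rfl
  map_mul' _ _ := rfl
  map_zero' := rfl
  map_add' _ _ := rfl

/-- The group ring `R = 𝔽_p[ℤ]`. -/
abbrev R (p : ℕ) : Type := AddMonoidAlgebra (ZMod p) ℤ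

/-- The ideals of `R` of finite index: they define the profinite completion of the ring `R`. -/
def finiteIdeals (p : ℕ) : Set (Ideal (R p)) := {I | Finite (R p ⧸ I)}

/-- The ideals `I` of `R` of finite index such that the image of the group `ℤ` in the unit group
of `R ⧸ I` is a `p`-group: they define the pro-`p` completion of the group ring `R`. -/
def finitePIdeals (p : ℕ) : Set (Ideal (R p)) :=
  {I | Finite (R p ⧸ I) ∧
    ∀ g : ℤ, ∃ k : ℕ, (Ideal.Quotient.mk I (AddMonoidAlgebra.single g 1)) ^ p ^ k = 1}

/-! ### Completed group rings -/

section Completed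

variable {ι : Type} (p n : ℕ) (μ : ι → ℕ)

/-- The ring homomorphism `𝔽_p[ℤ/e] → 𝔽_p[ℤ/d]` induced by the reduction `ℤ/e → ℤ/d`, `d ∣ e`. -/
noncomputable def reduce {d e : ℕ} (h : d ∣ e) :
    AddMonoidAlgebra (ZMod p) (ZMod e) →+* AddMonoidAlgebra (ZMod p) (ZMod d) :=
  AddMonoidAlgebra.mapDomainRingHom (ZMod p) (ZMod.castHom h (ZMod d)).toAddMonoidHom

/-- Compatible families in the product of the group rings `𝔽_p[ℤ/μ(i)]`. -/
noncomputable def groupRingLimit :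
    Subring (∀ i : ι, AddMonoidAlgebra (ZMod p) (ZMod (μ i))) where
  carrier := {f | ∀ (i j : ι) (h : μ i ∣ μ j), reduce p h (f j) = f i}
  mul_mem' := by
    intro a b ha hb I J h
    simp only [Pi.mul_apply, map_mul, ha I J h, hb I J h]
  one_mem' := by
    intro I J h
    simp only [Pi.one_apply, map_one]
  add_mem' := by
    intro a b ha hb I J h
    simp only [Pi.add_apply, map_add, ha I J h, hb I J h]
  zero_mem' := by
    intro I J h
    simp only [Pi.zero_apply, map_zero]
  neg_mem' := by
    intro a ha I J h
    simp only [Pi.neg_apply, map_neg, ha I J h]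

/-- The ring `lim_i 𝔽_p[ℤ/μ(i)]`, the limit over the moduli `μ(i)` ordered by divisibility. -/
def CompletedGroupRing : Type := groupRingLimit p μ

noncomputable instance : CommRing (CompletedGroupRing p μ) :=
  inferInstanceAs (CommRing (groupRingLimit p μ))

/-- The projective limit topology: induced by the product of the discrete topologies. -/
instance : TopologicalSpace (CompletedGroupRing p μ) :=
  TopologicalSpace.induced (fun f : groupRingLimit p μ => f.1)
    (@Pi.topologicalSpace _ _ fun _ => ⊥)

/-- The canonical map `R = 𝔽_p[ℤ] → lim_i 𝔽_p[ℤ/μ(i)]`. -/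
noncomputable def toCompletedGroupRing : R p →+* CompletedGroupRing p μ :=
  RingHom.codRestrict
    (RingHom.pi fun i =>
      AddMonoidAlgebra.mapDomainRingHom (ZMod p) (Int.castAddHom (ZMod (μ i))))
    (groupRingLimit p μ) (by
      intro r i j h
      change (reduce p h).comp (AddMonoidAlgebra.mapDomainRingHom (ZMod p)
        (Int.castAddHom (ZMod (μ j)))) r = _
      rw [reduce, ← AddMonoidAlgebra.mapDomainRingHom_comp, RingHom.pi_apply]
      congr 2
      exact AddMonoidHom.ext fun k => map_intCast (ZMod.castHom h (ZMod (μ i))) k)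

variable {μ} {T : Type} [AddCommGroup T] (π : ∀ i, T →+ ZMod (μ i))
  (hπ : ∀ (i j : ι) (h : μ i ∣ μ j) (t : T), ZMod.castHom h (ZMod (μ i)) (π j t) = π i t)

/-- Given a group `T` with compatible maps `π i : T → ℤ/μ(i)`, the homomorphism sending `t` to the
group-like element `[t] = ([π i t])_i` of `lim_i 𝔽_p[ℤ/μ(i)]`. -/
noncomputable def groupLike : Multiplicative T →* CompletedGroupRing p μ where
  toFun t := (⟨fun i => AddMonoidAlgebra.single (π i t.toAdd) 1, by
    intro i j h
    simp [reduce, ← hπ i j h]⟩ : groupRingLimit p μ)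
  map_one' := by
    refine Subtype.ext (funext fun i => ?_)
    change AddMonoidAlgebra.single (π i 0) 1 = 1
    rw [map_zero]
    rfl
  map_mul' s t := by
    refine Subtype.ext (funext fun i => ?_)
    refine Eq.trans ?_ (AddMonoidAlgebra.single_mul_single _ _ _ _).symm
    change AddMonoidAlgebra.single (π i (s.toAdd + t.toAdd)) 1 = _
    rw [map_add, one_mul]

end Completed

/-! ### Semidirect products -/

/-- A homomorphism `γ : H → A` from a group to a commutative ring lets `H` act on the additive group
`A^n` by `h • a = γ(h) a`. -/
def scalarAction (n : ℕ) {H A : Type} [Group H] [CommRing A] (γ : H →* A) :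
    H →* MulAut (Multiplicative (Fin n → A)) where
  toFun h := AddEquiv.toMultiplicative
    { toFun := fun a k => γ h * a k
      invFun := fun a k => γ h⁻¹ * a k
      left_inv := fun a => by
        funext k
        change γ h⁻¹ * (γ h * a k) = a k
        rw [← mul_assoc, ← map_mul, inv_mul_cancel, map_one, one_mul]
      right_inv := fun a => by
        funext k
        change γ h * (γ h⁻¹ * a k) = a k
        rw [← mul_assoc, ← map_mul, mul_inv_cancel, map_one, one_mul]
      map_add' := fun a b => by
        funext k
        exact mul_add _ _ _ }
  map_one' := by
    ext a k
    change γ 1 * a k = a k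
    rw [map_one, one_mul]
  map_mul' g h := by
    ext a k
    change γ (g * h) * a k = γ g * (γ h * a k)
    rw [map_mul, mul_assoc]

/-- A semidirect product of topological groups carries the product topology. -/
instance {N G : Type*} [Group N] [Group G] [TopologicalSpace N] [TopologicalSpace G]
    {φ : G →* MulAut N} : TopologicalSpace (N ⋊[φ] G) :=
  TopologicalSpace.induced (fun g => (g.left, g.right)) inferInstance

/-! ### The two concrete groups -/

/-- `𝔽_p[[ℤ_p]] = lim_m 𝔽_p[ℤ/p^m]`. -/
abbrev FpZp (p : ℕ) : Type := CompletedGroupRing p (fun m : ℕ => p ^ m)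

/-- `𝔽_p[[ẑ]] = lim_m 𝔽_p[ℤ/m]`, over `m ≥ 1` ordered by divisibility. -/
abbrev FpZHat (p : ℕ) : Type := CompletedGroupRing p (fun m : ℕ+ => (m : ℕ))

/-- Compatible families in the product of the groups `ℤ/m`, `m ≥ 1`. -/
def zHatSubgroup : AddSubgroup (∀ m : ℕ+, ZMod m) where
  carrier := {f | ∀ (m k : ℕ+) (h : (m : ℕ) ∣ k), ZMod.castHom h (ZMod m) (f k) = f m}
  add_mem' := by
    intro a b ha hb I J h
    simp only [Pi.add_apply, map_add, ha I J h, hb I J h]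
  zero_mem' := by
    intro I J h
    simp only [Pi.zero_apply, map_zero]
  neg_mem' := by
    intro a ha I J h
    simp only [Pi.neg_apply, map_neg, ha I J h]

/-- The group `lim_m ℤ/m`, over `m ≥ 1` ordered by divisibility. -/
def ZHat : Type := zHatSubgroup

instance : AddCommGroup ZHat := inferInstanceAs (AddCommGroup zHatSubgroup)

/-- The projective limit topology: induced by the product of the discrete topologies. -/
instance : TopologicalSpace ZHat :=
  TopologicalSpace.induced (fun f : zHatSubgroup => f.1) (@Pi.topologicalSpace _ _ fun _ => ⊥)

/-- The projection to `ℤ/m`. -/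
def ZHat.proj (m : ℕ+) : ZHat →+ ZMod m where
  toFun z := z.1 m
  map_zero' := rfl
  map_add' _ _ := rfl

/-- The canonical map `ℤ → lim_m ℤ/m`. -/
def intToZHat : ℤ →+ ZHat where
  toFun k := (⟨fun m => (k : ZMod m), by
    intro i j h
    simp⟩ : zHatSubgroup)
  map_zero' := Subtype.ext (funext fun _ => Int.cast_zero)
  map_add' a b := Subtype.ext (funext fun _ => Int.cast_add a b)

section Padic

variable (p : ℕ) [Fact p.Prime]

/-- `ℤ_p → 𝔽_p[[ℤ_p]]`, `a ↦ ([a mod p^m])_m`. -/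
noncomputable def padicGroupLike : Multiplicative ℤ_[p] →* FpZp p :=
  groupLike p (fun m => (PadicInt.toZModPow m : ℤ_[p] →+* ZMod (p ^ m)).toAddMonoidHom) (by
    intro i j h t
    have hij : i ≤ j := (Nat.pow_dvd_pow_iff_le_right (Fact.out : p.Prime).one_lt).1 h
    exact PadicInt.cast_toZModPow i j hij t)

/-- `𝔽_p[[ℤ_p]]^n ⋊ ℤ_p`, where `a ∈ ℤ_p` acts by multiplication by `[a] ∈ 𝔽_p[[ℤ_p]]`. -/
abbrev ProPTarget (n : ℕ) : Type :=
  Multiplicative (Fin n → FpZp p) ⋊[scalarAction n (padicGroupLike p)] Multiplicative ℤ_[p]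

end Padic

/-- `ẑ → 𝔽_p[[ẑ]]`, `a ↦ ([a mod m])_m`. -/
noncomputable def zHatGroupLike (p : ℕ) : Multiplicative ZHat →* FpZHat p :=
  groupLike p ZHat.proj (fun i j h t => t.2 i j h)

/-- `𝔽_p[[ẑ]]^n ⋊ ẑ`, where `a ∈ ẑ` acts by multiplication by `[a] ∈ 𝔽_p[[ẑ]]`. -/
abbrev ProfiniteTarget (p n : ℕ) : Type :=
  Multiplicative (Fin n → FpZHat p) ⋊[scalarAction n (zHatGroupLike p)] Multiplicative ZHat

/-! ### The canonical maps -/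

/-- The identification of the base group with `R^n`: the coefficient of `x^i` in the `k`-th
coordinate of the image of `v` is `v i k`. -/
noncomputable def baseToRing (p n : ℕ) : Base p n →+ (Fin n → R p) where
  toFun v k := AddMonoidAlgebra.ofCoeff (v.mapRange (fun w => w k) rfl)
  map_zero' := by
    funext k
    simp
  map_add' a b := by
    funext k
    rw [Finsupp.mapRange_add (fun _ _ => rfl)]
    rfl

theorem baseToRing_shift (p n : ℕ) (s : ℤ) (v : Base p n) (k : Fin n) :
    baseToRing p n (Finsupp.domCongr (Equiv.addRight s) v) k =
      AddMonoidAlgebra.single s 1 * baseToRing p n v k := by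
  ext i
  rw [AddMonoidAlgebra.coeff_single_mul_apply, one_mul]
  change v ((Equiv.addRight s).symm i) k = v (-s + i) k
  rw [Equiv.addRight_symm, Equiv.coe_addRight, add_comm]

/-- The homomorphism `ℒ_n → A^n ⋊ T` induced by `θ : R → A` and `τ : ℤ → T`: it sends `(v, s)` to
`(θ(v), τ(s))`, the base group being identified with `R^n`. -/
noncomputable def semidirectMap {p n : ℕ} {A T : Type} [CommRing A] [AddCommGroup T]
    (γ : Multiplicative T →* A) (θ : R p →+* A) (τ : ℤ →+ T)
    (h : ∀ s : ℤ, γ (Multiplicative.ofAdd (τ s)) = θ (AddMonoidAlgebra.single s 1)) :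
    L p n →* Multiplicative (Fin n → A) ⋊[scalarAction n γ] Multiplicative T :=
  SemidirectProduct.map
    (AddMonoidHom.toMultiplicative
      { toFun := fun v k => θ (baseToRing p n v k)
        map_zero' := by
          funext k
          simp
        map_add' := fun a b => by
          funext k
          simp })
    (AddMonoidHom.toMultiplicative τ) (by
      intro s
      refine MonoidHom.ext fun v => funext fun k => ?_
      change θ (baseToRing p n (Finsupp.domCongr (Equiv.addRight s.toAdd) v.toAdd) k) =
        γ (Multiplicative.ofAdd (τ s.toAdd)) * θ (baseToRing p n v.toAdd k)
      rw [baseToRing_shift, map_mul, h])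

/-- The canonical map `ℒ_n → 𝔽_p[[ℤ_p]]^n ⋊ ℤ_p`. -/
noncomputable def toProPTarget (p n : ℕ) [Fact p.Prime] : L p n →* ProPTarget p n :=
  semidirectMap (padicGroupLike p) (toCompletedGroupRing p _) (Int.castAddHom ℤ_[p]) (by
    intro s
    refine Subtype.ext (funext fun m => ?_)
    change AddMonoidAlgebra.single (PadicInt.toZModPow m (s : ℤ_[p])) 1 =
      AddMonoidAlgebra.mapDomainRingHom (ZMod p) (Int.castAddHom (ZMod (p ^ m)))
        (AddMonoidAlgebra.single s 1)
    simp [-LaurentPolynomial.single_eq_C_mul_T, AddMonoidAlgebra.mapDomain_single])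

/-- The canonical map `ℒ_n → 𝔽_p[[ẑ]]^n ⋊ ẑ`. -/
noncomputable def toProfiniteTarget (p n : ℕ) : L p n →* ProfiniteTarget p n :=
  semidirectMap (zHatGroupLike p) (toCompletedGroupRing p _) intToZHat (by
    intro s
    refine Subtype.ext (funext fun m => ?_)
    change AddMonoidAlgebra.single ((s : ZMod m)) 1 =
      AddMonoidAlgebra.mapDomainRingHom (ZMod p) (Int.castAddHom (ZMod m))
        (AddMonoidAlgebra.single s 1)
    simp [-LaurentPolynomial.single_eq_C_mul_T, AddMonoidAlgebra.mapDomain_single])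

end LamplighterCompletion

namespace LamplighterCompletion

open Filter Topology

/-! ### Comparing two completions of a group -/

section Comparison

/-- A homomorphism to a compact group extends along a homomorphism with dense range to a compact
group, if it is continuous for the topology induced by the latter. -/
@[to_additive]
theorem exists_continuous_monoidHom_extension {G C H : Type*} [Group G] [Group C] [Group H]
    [TopologicalSpace C] [TopologicalSpace H] [IsTopologicalGroup C] [IsTopologicalGroup H]
    [CompactSpace C] [CompactSpace H] [T2Space C] [T2Space H]
    (i : G →* C) (j : G →* H) (hi : DenseRange i) (hij : comap i (𝓝 1) ≤ comap j (𝓝 1)) :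
    ∃ e : C →* H, Continuous e ∧ ∀ g, e (i g) = j g := by
  let K : Subgroup (C × H) := (i.prod j).range.topologicalClosure
  have hmem : ∀ g, (i g, j g) ∈ K := fun g => subset_closure ⟨g, rfl⟩
  have : CompactSpace K := isCompact_iff_compactSpace.1 isClosed_closure.isCompact
  let φ : K →* C := (MonoidHom.fst C H).comp K.subtype
  have hφ : Continuous φ := continuous_fst.comp continuous_subtype_val
  have hinj : Function.Injective φ := by
    rw [injective_iff_map_eq_one]
    rintro ⟨⟨c, h⟩, hc⟩ (rfl : c = 1)
    by_contra hne
    have hh : h ≠ 1 := by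
      rintro rfl
      exact hne rfl
    obtain ⟨u, v, hu, hv, hhu, h1v, huv⟩ := t2_separation hh
    obtain ⟨W, hW, hWv⟩ := hij (preimage_mem_comap (hv.mem_nhds h1v))
    have hc' : ((1 : C), h) ∈ closure (Set.range (i.prod j)) := hc
    obtain ⟨_, ⟨h1, h2⟩, g, rfl⟩ :=
      mem_closure_iff_nhds.1 hc' _ (prod_mem_nhds hW (hu.mem_nhds hhu))
    exact Set.disjoint_left.1 huv h2 (hWv h1)
  have hsurj : Function.Surjective φ := by
    have hcl : IsClosed (Set.range φ) := (isCompact_range hφ).isClosed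
    have hd : Dense (Set.range φ) := hi.mono (by
      rintro _ ⟨g, rfl⟩
      exact ⟨⟨_, hmem g⟩, rfl⟩)
    exact Set.range_eq_univ.1 (hcl.closure_eq ▸ hd.closure_eq)
  let E : K ≃* C := MulEquiv.ofBijective φ ⟨hinj, hsurj⟩
  have hE : Continuous E.symm :=
    (Continuous.homeoOfEquivCompactToT2 (f := E.toEquiv) hφ).symm.continuous
  refine ⟨((MonoidHom.snd C H).comp K.subtype).comp E.symm.toMonoidHom,
    (continuous_snd.comp continuous_subtype_val).comp hE, fun g => ?_⟩
  have : E.symm (i g) = ⟨_, hmem g⟩ := by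
    rw [MulEquiv.symm_apply_eq]
    rfl
  change (E.symm (i g)).1.2 = _
  rw [this]

/-- Two compact groups with homomorphisms with dense range from `G` are isomorphic under `G`, if
they induce the same topology on `G`. -/
@[to_additive]
theorem exists_continuousMulEquiv {G C H : Type*} [Group G] [Group C] [Group H]
    [TopologicalSpace C] [TopologicalSpace H] [IsTopologicalGroup C] [IsTopologicalGroup H]
    [CompactSpace C] [CompactSpace H] [T2Space C] [T2Space H]
    (i : G →* C) (j : G →* H) (hi : DenseRange i) (hj : DenseRange j)
    (hij : comap i (𝓝 1) = comap j (𝓝 1)) :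
    ∃ e : C ≃ₜ* H, ∀ g, e (i g) = j g := by
  obtain ⟨a, ha, hai⟩ := exists_continuous_monoidHom_extension i j hi hij.le
  obtain ⟨b, hb, hbj⟩ := exists_continuous_monoidHom_extension j i hj hij.ge
  have hba : ∀ c, b (a c) = c := fun c =>
    congrFun (hi.equalizer (hb.comp ha) continuous_id (by funext g; simp [hai, hbj])) c
  have hab : ∀ c, a (b c) = c := fun c =>
    congrFun (hj.equalizer (ha.comp hb) continuous_id (by funext g; simp [hai, hbj])) c
  exact ⟨{ toFun := a, invFun := b, left_inv := hba, right_inv := hab, map_mul' := map_mul a,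
           continuous_toFun := ha, continuous_invFun := hb }, hai⟩

/-- Two compact rings with homomorphisms with dense range from `A` are isomorphic under `A`, if
they induce the same topology on `A`. -/
theorem exists_isHomeomorph_ringEquiv {A C H : Type*} [Ring A] [Ring C] [Ring H]
    [TopologicalSpace C] [TopologicalSpace H] [IsTopologicalRing C] [IsTopologicalRing H]
    [CompactSpace C] [CompactSpace H] [T2Space C] [T2Space H]
    (i : A →+* C) (j : A →+* H) (hi : DenseRange i) (hj : DenseRange j)
    (hij : comap i (𝓝 0) = comap j (𝓝 0)) :
    ∃ e : C ≃+* H, IsHomeomorph e ∧ ∀ a, e (i a) = j a := by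
  obtain ⟨e, he⟩ := exists_continuousAddEquiv i.toAddMonoidHom j.toAddMonoidHom hi hj hij
  replace he : ∀ a, e (i a) = j a := he
  have hmul : ∀ x y, e (x * y) = e x * e y := fun x y =>
    hi.induction_on₂ (p := fun x y => e (x * y) = e x * e y)
      (isClosed_eq (by fun_prop) (by fun_prop))
      (fun a b => by rw [← map_mul, he, he, he, map_mul]) x y
  exact ⟨{ e.toAddEquiv with map_mul' := hmul }, e.toHomeomorph.isHomeomorph, he⟩

end Comparison

/-! ### Projective limits of discrete spaces -/

/-- The map `f` identifies `X` with a closed subspace of the product of the discrete spaces `Y i`,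
in which the coordinates are directed. -/
structure IsProjLimit {X ι : Type*} [t : TopologicalSpace X] {Y : ι → Type*}
    (f : X → ∀ i, Y i) : Prop where
  induced : t = TopologicalSpace.induced f (@Pi.topologicalSpace _ _ fun _ => ⊥)
  injective : Function.Injective f
  isClosed : @IsClosed _ (@Pi.topologicalSpace _ _ fun _ => ⊥) (Set.range f)
  directed : ∀ i j, ∃ k, ∀ x y, f x k = f y k → f x i = f y i ∧ f x j = f y j

/-- The compatible families form a closed subset of a product of discrete spaces. -/
theorem isClosed_range_of_compatible {X ι : Type*} {Y : ι → Type*} {f : X → ∀ i, Y i}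
    (P : ι → ι → Prop) (r : ∀ i j, P i j → Y i → Y j)
    (hf : ∀ z, z ∈ Set.range f ↔ ∀ i j (h : P i j), r i j h (z i) = z j) :
    @IsClosed _ (@Pi.topologicalSpace _ _ fun _ => ⊥) (Set.range f) := by
  let _ : ∀ i, TopologicalSpace (Y i) := fun _ => ⊥
  have : ∀ i, DiscreteTopology (Y i) := fun _ => ⟨rfl⟩
  rw [show Set.range f = {z | ∀ i j (h : P i j), r i j h (z i) = z j} from Set.ext hf]
  simp only [Set.ofPred_forall]
  exact isClosed_iInter fun i => isClosed_iInter fun j => isClosed_iInter fun h =>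
    isClosed_eq (continuous_of_discreteTopology.comp (continuous_apply i)) (continuous_apply j)

namespace IsProjLimit

variable {X ι : Type*} [TopologicalSpace X] {Y : ι → Type*} {f : X → ∀ i, Y i}

theorem t2Space (hf : IsProjLimit f) : T2Space X := by
  let _ : ∀ i, TopologicalSpace (Y i) := fun _ => ⊥
  have : ∀ i, DiscreteTopology (Y i) := fun _ => ⟨rfl⟩
  exact T2Space.of_injective_continuous hf.injective (continuous_iff_le_induced.2 hf.induced.le)

theorem compactSpace (hf : IsProjLimit f) [∀ i, Finite (Y i)] : CompactSpace X := by
  let _ : ∀ i, TopologicalSpace (Y i) := fun _ => ⊥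
  have : ∀ i, DiscreteTopology (Y i) := fun _ => ⟨rfl⟩
  exact (Topology.IsClosedEmbedding.mk ⟨⟨hf.induced⟩, hf.injective⟩ hf.isClosed).compactSpace

theorem nhds_hasBasis (hf : IsProjLimit f) [Nonempty ι] (x : X) :
    (𝓝 x).HasBasis (fun _ : ι => True) (fun i => {y | f y i = f x i}) := by
  let _ : ∀ i, TopologicalSpace (Y i) := fun _ => ⊥
  have : ∀ i, DiscreteTopology (Y i) := fun _ => ⟨rfl⟩
  have hind : Topology.IsInducing f := ⟨hf.induced⟩
  refine ⟨fun U => ⟨fun hU => ?_, ?_⟩⟩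
  · rw [hind.nhds_eq_comap, mem_comap] at hU
    obtain ⟨V, hV, hVU⟩ := hU
    rw [nhds_pi, Filter.mem_pi] at hV
    obtain ⟨I, hI, t, ht, htV⟩ := hV
    have hdir : ∀ J : Set ι, J.Finite → ∃ k, ∀ y, f y k = f x k → ∀ i ∈ J, f y i = f x i := by
      intro J hJ
      induction J, hJ using Set.Finite.induction_on with
      | empty => exact ⟨Classical.arbitrary ι, fun _ _ _ h => h.elim⟩
      | @insert a s _ _ ih =>
        obtain ⟨k, hk⟩ := ih
        obtain ⟨l, hl⟩ := hf.directed a k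
        refine ⟨l, fun y hy i hi => ?_⟩
        obtain ⟨h1, h2⟩ := hl _ _ hy
        rcases hi with rfl | hi
        · exact h1
        · exact hk y h2 i hi
    obtain ⟨k, hk⟩ := hdir I hI
    refine ⟨k, trivial, fun y hy => hVU (htV fun i hi => ?_)⟩
    rw [hk y hy i hi]
    exact mem_of_mem_nhds (ht i)
  · rintro ⟨i, -, hi⟩
    refine mem_of_superset ?_ hi
    have hc : Continuous fun y => f y i := (continuous_apply i).comp hind.continuous
    exact ((isOpen_discrete {f x i}).preimage hc).mem_nhds rfl

theorem comap_nhds_hasBasis (hf : IsProjLimit f) [Nonempty ι] {G : Type*} (φ : G → X) (x : X) :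
    (comap φ (𝓝 x)).HasBasis (fun _ : ι => True) (fun i => {g | f (φ g) i = f x i}) :=
  (hf.nhds_hasBasis x).comap φ

theorem denseRange (hf : IsProjLimit f) [Nonempty ι] {G : Type*} (φ : G → X)
    (h : ∀ x i, ∃ g, f (φ g) i = f x i) : DenseRange φ := fun x =>
  (mem_closure_iff_nhds_basis (hf.nhds_hasBasis x)).2 fun i _ =>
    let ⟨g, hg⟩ := h x i
    ⟨φ g, ⟨g, rfl⟩, hg⟩

end IsProjLimit

/-! ### The completions are projective limits -/

section Groups

variable {G : Type} [Group G]

theorem isProjLimit_proPCompletion (p : ℕ) [Fact p.Prime] :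
    IsProjLimit (fun f : ProPCompletion p G => f.1) where
  induced := rfl
  injective := Subtype.val_injective
  isClosed := isClosed_range_of_compatible (fun N M => N.1 ≤ M.1)
    (fun N M h => QuotientGroup.map N.1 M.1 (MonoidHom.id G) h)
    fun z => ⟨by rintro ⟨x, rfl⟩; exact x.2, fun hz => ⟨⟨z, hz⟩, rfl⟩⟩
  directed N M := by
    have hN := N.2.1
    have hM := M.2.1
    obtain ⟨a, ha⟩ := N.2.2
    obtain ⟨b, hb⟩ := M.2.2
    have hdvd : (N.1 ⊓ M.1).index ∣ p ^ (a + b) := by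
      rw [pow_add, ← ha, ← hb, ← Subgroup.relIndex_mul_index (inf_le_right : N.1 ⊓ M.1 ≤ M.1),
        Subgroup.inf_relIndex_right]
      exact mul_dvd_mul_right (Subgroup.relIndex_dvd_index_of_normal _ _) _
    obtain ⟨c, -, hc⟩ := (Nat.dvd_prime_pow Fact.out).1 hdvd
    let K : PNormal p G := ⟨N.1 ⊓ M.1, inferInstance, c, hc⟩
    refine ⟨K, fun x y h => ⟨?_, ?_⟩⟩
    · exact (x.2 K N inf_le_left).symm.trans
        ((congrArg _ h).trans (y.2 K N inf_le_left))
    · exact (x.2 K M inf_le_right).symm.trans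
        ((congrArg _ h).trans (y.2 K M inf_le_right))

instance (p : ℕ) : IsTopologicalGroup (ProPCompletion p G) := by
  let _ : ∀ N : PNormal p G, TopologicalSpace (G ⧸ N.1) := fun _ => ⊥
  have : ∀ N : PNormal p G, DiscreteTopology (G ⧸ N.1) := fun _ => ⟨rfl⟩
  exact topologicalGroup_induced (proPSubgroup p G).subtype

instance (p : ℕ) : Nonempty (PNormal p G) :=
  ⟨⟨⊤, inferInstance, 0, by simp⟩⟩

variable (G) in
theorem comap_toProPCompletion_hasBasis (p : ℕ) [Fact p.Prime] :
    (comap (toProPCompletion p G) (𝓝 1)).HasBasis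
      (fun N : Subgroup G => N.Normal ∧ ∃ k, N.index = p ^ k) (fun N => (N : Set G)) := by
  refine ((isProjLimit_proPCompletion p).comap_nhds_hasBasis (toProPCompletion p G) 1).to_hasBasis
    (fun N _ => ⟨N.1, N.2, fun g hg => (QuotientGroup.eq_one_iff g).2 hg⟩)
    (fun N hN => ⟨⟨N, hN⟩, trivial, fun g hg => ?_⟩)
  have := hN.1
  exact (QuotientGroup.eq_one_iff g).1 hg

variable (G) in
theorem denseRange_toProPCompletion (p : ℕ) [Fact p.Prime] : DenseRange (toProPCompletion p G) :=
  (isProjLimit_proPCompletion p).denseRange _ fun x N =>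
    let ⟨g, hg⟩ := QuotientGroup.mk_surjective (x.1 N)
    ⟨g, hg⟩

theorem compactSpace_proPCompletion (p : ℕ) [Fact p.Prime] : CompactSpace (ProPCompletion p G) := by
  have : ∀ N : PNormal p G, Finite (G ⧸ N.1) := fun N => by
    obtain ⟨k, hk⟩ := N.2.2
    refine Nat.finite_of_card_ne_zero ?_
    change N.1.index ≠ 0
    rw [hk]
    exact pow_ne_zero _ (Fact.out : p.Prime).ne_zero
  exact (isProjLimit_proPCompletion p).compactSpace

open ProfiniteGrp.ProfiniteCompletion in
theorem isProjLimit_profiniteCompletion :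
    IsProjLimit (fun (f : completion (GrpCat.of G)) (N : FiniteIndexNormalSubgroup G) =>
      (f.1 N : G ⧸ N.toSubgroup)) where
  induced := rfl
  injective := Subtype.val_injective
  isClosed := isClosed_range_of_compatible (fun N M => N ≤ M)
    (fun N M h => QuotientGroup.map N.1 M.1 (MonoidHom.id G) h)
    fun z => ⟨by
      rintro ⟨x, rfl⟩ N M h
      exact x.2 (CategoryTheory.homOfLE h), fun hz => ⟨⟨z, fun N M h => hz N M h.le⟩, rfl⟩⟩
  directed N M := by
    refine ⟨N ⊓ M, fun x y h => ⟨?_, ?_⟩⟩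
    · exact (x.2 (CategoryTheory.homOfLE inf_le_left)).symm.trans
        ((congrArg _ h).trans (y.2 (CategoryTheory.homOfLE inf_le_left)))
    · exact (x.2 (CategoryTheory.homOfLE inf_le_right)).symm.trans
        ((congrArg _ h).trans (y.2 (CategoryTheory.homOfLE inf_le_right)))

/-- The canonical homomorphism from `G` to its profinite completion. -/
def toProfiniteCompletion (G : Type) [Group G] :
    G →* ProfiniteGrp.ProfiniteCompletion.completion (GrpCat.of G) where
  toFun := ProfiniteGrp.ProfiniteCompletion.etaFn (GrpCat.of G)
  map_one' := rfl
  map_mul' _ _ := rfl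

variable (G) in
theorem comap_toProfiniteCompletion_hasBasis :
    (comap (toProfiniteCompletion G) (𝓝 1)).HasBasis
      (fun N : Subgroup G => N.Normal ∧ N.index ≠ 0) (fun N => (N : Set G)) := by
  have : Nonempty (FiniteIndexNormalSubgroup G) := ⟨FiniteIndexNormalSubgroup.ofSubgroup ⊤⟩
  refine (isProjLimit_profiniteCompletion.comap_nhds_hasBasis
    (toProfiniteCompletion G) 1).to_hasBasis
    (fun N _ => ⟨N.1, ⟨inferInstance, Subgroup.FiniteIndex.index_ne_zero⟩,
      fun g hg => (QuotientGroup.eq_one_iff g).2 hg⟩)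
    (fun N hN => ?_)
  have := hN.1
  have : N.FiniteIndex := ⟨hN.2⟩
  exact ⟨FiniteIndexNormalSubgroup.ofSubgroup N, trivial, fun g hg =>
    (QuotientGroup.eq_one_iff g).1 hg⟩

end Groups

section Rings

variable {A : Type*} [CommRing A] {F : Set (Ideal A)}

theorem isProjLimit_idealCompletion (hF : ∀ I ∈ F, ∀ J ∈ F, I ⊓ J ∈ F) :
    IsProjLimit (fun f : IdealCompletion F => f.1) where
  induced := rfl
  injective := Subtype.val_injective
  isClosed := isClosed_range_of_compatible (fun I J => I.1 ≤ J.1)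
    (fun I J h => Ideal.Quotient.factor h)
    fun z => ⟨by rintro ⟨x, rfl⟩; exact x.2, fun hz => ⟨⟨z, hz⟩, rfl⟩⟩
  directed I J := by
    let K : F := ⟨I.1 ⊓ J.1, hF _ I.2 _ J.2⟩
    refine ⟨K, fun x y h => ⟨?_, ?_⟩⟩
    · exact (x.2 K I inf_le_left).symm.trans
        ((congrArg _ h).trans (y.2 K I inf_le_left))
    · exact (x.2 K J inf_le_right).symm.trans
        ((congrArg _ h).trans (y.2 K J inf_le_right))

/-- A ring with the topology induced by a homomorphism to a product of discrete rings is a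
topological ring. -/
theorem isTopologicalRing_induced_pi {B ι : Type*} {Y : ι → Type*} [Ring B] [∀ i, Ring (Y i)]
    (φ : B →+* ∀ i, Y i) :
    @IsTopologicalRing B (TopologicalSpace.induced φ (@Pi.topologicalSpace _ _ fun _ => ⊥)) _ := by
  let _ : ∀ i, TopologicalSpace (Y i) := fun _ => ⊥
  have : ∀ i, DiscreteTopology (Y i) := fun _ => ⟨rfl⟩
  let _ : TopologicalSpace B := TopologicalSpace.induced φ inferInstance
  have : IsTopologicalAddGroup B := topologicalAddGroup_induced φ
  have : ContinuousMul B := continuousMul_induced φ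
  exact {}

instance : IsTopologicalRing (IdealCompletion F) :=
  isTopologicalRing_induced_pi (idealLimit F).subtype

theorem comap_toIdealCompletion_hasBasis (hF : ∀ I ∈ F, ∀ J ∈ F, I ⊓ J ∈ F) (htop : ⊤ ∈ F) :
    (comap (toIdealCompletion F) (𝓝 0)).HasBasis (· ∈ F) (fun I => (I : Set A)) := by
  have : Nonempty F := ⟨⟨⊤, htop⟩⟩
  exact ((isProjLimit_idealCompletion hF).comap_nhds_hasBasis (toIdealCompletion F) 0).to_hasBasis
    (fun I _ => ⟨I.1, I.2, fun g hg => Ideal.Quotient.eq_zero_iff_mem.2 hg⟩)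
    (fun I hI => ⟨⟨I, hI⟩, trivial, fun g hg => Ideal.Quotient.eq_zero_iff_mem.1 hg⟩)

theorem denseRange_toIdealCompletion (hF : ∀ I ∈ F, ∀ J ∈ F, I ⊓ J ∈ F) (htop : ⊤ ∈ F) :
    DenseRange (toIdealCompletion F) := by
  have : Nonempty F := ⟨⟨⊤, htop⟩⟩
  exact (isProjLimit_idealCompletion hF).denseRange _ fun x I =>
    let ⟨g, hg⟩ := Ideal.Quotient.mk_surjective (x.1 I)
    ⟨g, hg⟩

end Rings

section CompletedGroupRing

variable {ι : Type} (p n : ℕ) {μ : ι → ℕ}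

instance : IsTopologicalRing (CompletedGroupRing p μ) :=
  isTopologicalRing_induced_pi (groupRingLimit p μ).subtype

theorem isProjLimit_completedGroupRing (hμ : ∀ i j, ∃ k, μ i ∣ μ k ∧ μ j ∣ μ k) :
    IsProjLimit (fun f : CompletedGroupRing p μ => f.1) where
  induced := rfl
  injective := Subtype.val_injective
  isClosed := isClosed_range_of_compatible (fun j i => μ i ∣ μ j)
    (fun j i h => reduce p h)
    fun z => ⟨by rintro ⟨x, rfl⟩ j i; exact x.2 i j, fun hz => ⟨⟨z, fun i j => hz j i⟩, rfl⟩⟩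
  directed i j := by
    obtain ⟨k, hi, hj⟩ := hμ i j
    exact ⟨k, fun x y h => ⟨(x.2 i k hi).symm.trans ((congrArg _ h).trans (y.2 i k hi)),
      (x.2 j k hj).symm.trans ((congrArg _ h).trans (y.2 j k hj))⟩⟩

instance [NeZero p] (m : ℕ) [NeZero m] : Finite (AddMonoidAlgebra (ZMod p) (ZMod m)) :=
  Finite.of_equiv _ AddMonoidAlgebra.coeffEquiv.symm

/-- The homomorphism `𝔽_p[ℤ] → 𝔽_p[ℤ/m]`. -/
noncomputable def levelRingHom (m : ℕ) : R p →+* AddMonoidAlgebra (ZMod p) (ZMod m) :=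
  AddMonoidAlgebra.mapDomainRingHom (ZMod p) (Int.castAddHom (ZMod m))

theorem levelRingHom_single (m : ℕ) (k : ℤ) (c : ZMod p) :
    levelRingHom p m (AddMonoidAlgebra.single k c) = AddMonoidAlgebra.single (k : ZMod m) c :=
  AddMonoidAlgebra.mapDomain_single ..

theorem levelRingHom_surjective (m : ℕ) : Function.Surjective (levelRingHom p m) := by
  intro x
  induction x using AddMonoidAlgebra.induction_linear with
  | zero => exact ⟨0, map_zero _⟩
  | add x y hx hy =>
    obtain ⟨a, rfl⟩ := hx
    obtain ⟨b, rfl⟩ := hy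
    exact ⟨a + b, map_add _ _ _⟩
  | single k c =>
    obtain ⟨k, rfl⟩ := ZMod.intCast_surjective k
    exact ⟨AddMonoidAlgebra.single k c, levelRingHom_single ..⟩

theorem denseRange_toCompletedGroupRing [Nonempty ι] (hμ : ∀ i j, ∃ k, μ i ∣ μ k ∧ μ j ∣ μ k) :
    DenseRange (toCompletedGroupRing p μ) :=
  (isProjLimit_completedGroupRing p hμ).denseRange _ fun x i =>
    levelRingHom_surjective p (μ i) (x.1 i)

theorem comap_toCompletedGroupRing_hasBasis [Nonempty ι]
    (hμ : ∀ i j, ∃ k, μ i ∣ μ k ∧ μ j ∣ μ k) :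
    (comap (toCompletedGroupRing p μ) (𝓝 0)).HasBasis (fun _ : ι => True)
      (fun i => (RingHom.ker (levelRingHom p (μ i)) : Set (R p))) :=
  (isProjLimit_completedGroupRing p hμ).comap_nhds_hasBasis _ 0

end CompletedGroupRing

section ZHat

theorem directed_pnat (i j : ℕ+) : ∃ k : ℕ+, (i : ℕ) ∣ k ∧ (j : ℕ) ∣ k :=
  ⟨i * j, by simp, by simp⟩

theorem isProjLimit_zHat : IsProjLimit (fun f : ZHat => f.1) where
  induced := rfl
  injective := Subtype.val_injective
  isClosed := isClosed_range_of_compatible (fun j i => (i : ℕ) ∣ j)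
    (fun j i h => ZMod.castHom h (ZMod i))
    fun z => ⟨by rintro ⟨x, rfl⟩ j i; exact x.2 i j, fun hz => ⟨⟨z, fun i j => hz j i⟩, rfl⟩⟩
  directed i j := by
    obtain ⟨k, hi, hj⟩ := directed_pnat i j
    exact ⟨k, fun x y h => ⟨(x.2 i k hi).symm.trans ((congrArg _ h).trans (y.2 i k hi)),
      (x.2 j k hj).symm.trans ((congrArg _ h).trans (y.2 j k hj))⟩⟩

instance : CompactSpace ZHat := isProjLimit_zHat.compactSpace

instance : T2Space ZHat := isProjLimit_zHat.t2Space

instance : IsTopologicalAddGroup ZHat := by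
  let _ : ∀ m : ℕ+, TopologicalSpace (ZMod m) := fun _ => ⊥
  have : ∀ m : ℕ+, DiscreteTopology (ZMod m) := fun _ => ⟨rfl⟩
  exact topologicalAddGroup_induced zHatSubgroup.subtype

theorem denseRange_intToZHat : DenseRange intToZHat :=
  isProjLimit_zHat.denseRange _ fun x m => ZMod.intCast_surjective (x.1 m)

theorem nhds_zHat_hasBasis :
    (𝓝 (0 : ZHat)).HasBasis (fun _ : ℕ+ => True) (fun m => {z | ZHat.proj m z = 0}) :=
  isProjLimit_zHat.nhds_hasBasis 0

end ZHat

theorem nhds_padicInt_hasBasis (p : ℕ) [Fact p.Prime] :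
    (𝓝 (0 : ℤ_[p])).HasBasis (fun _ : ℕ => True)
      (fun m => {z | (PadicInt.toZModPow m : ℤ_[p] →+* ZMod (p ^ m)).toAddMonoidHom z = 0}) := by
  have hp : (1 : ℝ) < p := by exact_mod_cast (Fact.out : p.Prime).one_lt
  have h := Metric.nhds_basis_closedBall_pow (x := (0 : ℤ_[p])) (r := (p : ℝ)⁻¹)
    (by positivity) (inv_lt_one_of_one_lt₀ hp)
  convert h using 2 with m
  ext z
  have : (PadicInt.toZModPow m : ℤ_[p] →+* ZMod (p ^ m)) z = 0 ↔ ‖z‖ ≤ (p : ℝ) ^ (-m : ℤ) := by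
    rw [PadicInt.norm_le_pow_iff_mem_span_pow, ← PadicInt.ker_toZModPow, RingHom.mem_ker]
  simpa using this

/-! ### Kernels of reduction modulo `m` -/

theorem mem_of_mapDomain_intCast_eq_zero {W : Type*} [AddCommGroup W] (P : AddSubgroup (ℤ →₀ W))
    (m : ℕ) (hP : ∀ (a : ℤ) (w : W), Finsupp.single a w - Finsupp.single (m + a) w ∈ P) (v : ℤ →₀ W)
    (hv : v.mapDomain (Int.cast : ℤ → ZMod m) = 0) : v ∈ P := by
  have hnat : ∀ (q : ℕ) (a : ℤ) (w : W), Finsupp.single a w - Finsupp.single (a + m * q) w ∈ P := by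
    intro q a w
    induction q with
    | zero => simp
    | succ q ih =>
      have := P.add_mem ih (hP (a + m * q) w)
      rw [sub_add_sub_cancel] at this
      convert this using 3
      push_cast
      ring
  have hint : ∀ (a b : ℤ) (w : W), (a : ZMod m) = b → Finsupp.single a w - Finsupp.single b w ∈ P := by
    intro a b w hab
    obtain ⟨q, hq⟩ := (ZMod.intCast_eq_intCast_iff_dvd_sub a b m).1 hab
    obtain ⟨q, rfl | rfl⟩ := q.eq_nat_or_neg
    · rw [eq_add_of_sub_eq' hq]
      exact hnat q a w
    · have ha : a = b + m * q := by linarith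
      rw [ha, ← neg_sub]
      exact P.neg_mem (hnat q b w)
  obtain ⟨σ, hσ⟩ := (ZMod.intCast_surjective (n := m)).hasRightInverse
  have hsub : ∀ u : ℤ →₀ W, u - u.mapDomain (fun a : ℤ => σ (a : ZMod m)) ∈ P := by
    intro u
    induction u using Finsupp.induction_linear with
    | zero => simp
    | add u₁ u₂ h₁ h₂ =>
      rw [Finsupp.mapDomain_add, add_sub_add_comm]
      exact P.add_mem h₁ h₂
    | single a w =>
      rw [Finsupp.mapDomain_single]
      exact hint _ _ _ (hσ _).symm
  have h0 : v.mapDomain (fun a : ℤ => σ (a : ZMod m)) = 0 := by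
    change v.mapDomain (σ ∘ (Int.cast : ℤ → ZMod m)) = 0
    rw [Finsupp.mapDomain_comp, hv, Finsupp.mapDomain_zero]
  simpa [h0] using hsub v

section Rings

variable (p : ℕ)

theorem ker_levelRingHom_le (m : ℕ) (I : Ideal (R p))
    (hI : AddMonoidAlgebra.single (m : ℤ) 1 - 1 ∈ I) : RingHom.ker (levelRingHom p m) ≤ I := by
  intro r hr
  refine mem_of_mapDomain_intCast_eq_zero
    (I.toAddSubgroup.comap AddMonoidAlgebra.coeffAddEquiv.symm.toAddMonoidHom) m
    (fun a w => ?_) r.coeff ?_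
  · change AddMonoidAlgebra.ofCoeff (Finsupp.single a w - Finsupp.single (m + a) w) ∈ I
    have : AddMonoidAlgebra.ofCoeff (Finsupp.single a w - Finsupp.single (m + a) w) =
        -(AddMonoidAlgebra.single (m : ℤ) (1 : ZMod p) - 1) * AddMonoidAlgebra.single a w := by
      rw [neg_sub, sub_mul, one_mul, AddMonoidAlgebra.single_mul_single, one_mul]
      rfl
    rw [this]
    exact I.mul_mem_right _ (I.neg_mem hI)
  · exact congrArg AddMonoidAlgebra.coeff (RingHom.mem_ker.1 hr)

theorem single_sub_one_mem_ker (m : ℕ) (g : ℤ) :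
    AddMonoidAlgebra.single g 1 ^ m - 1 ∈ RingHom.ker (levelRingHom p m) := by
  rw [RingHom.mem_ker, map_sub, map_pow, levelRingHom_single, AddMonoidAlgebra.single_pow, map_one,
    one_pow, nsmul_eq_mul, ZMod.natCast_self, zero_mul]
  exact sub_self _

variable {p}

theorem finite_quotient_ker_levelRingHom [NeZero p] (m : ℕ) [NeZero m] :
    Finite (R p ⧸ RingHom.ker (levelRingHom p m)) :=
  Finite.of_injective _ (RingHom.kerLift_injective (levelRingHom p m))

theorem inf_mem_finiteIdeals {I J : Ideal (R p)} (hI : I ∈ finiteIdeals p)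
    (hJ : J ∈ finiteIdeals p) : I ⊓ J ∈ finiteIdeals p := by
  have : Finite (R p ⧸ I) := hI
  have : Finite (R p ⧸ J) := hJ
  have h : RingHom.ker ((Ideal.Quotient.mk I).prod (Ideal.Quotient.mk J)) = I ⊓ J := by
    ext r
    simp [RingHom.mem_ker, Ideal.Quotient.eq_zero_iff_mem]
  rw [← h]
  exact Finite.of_injective _
    (RingHom.kerLift_injective ((Ideal.Quotient.mk I).prod (Ideal.Quotient.mk J)))

theorem mk_pow_eq_one_iff {A : Type*} [CommRing A] (I : Ideal A) (a : A) (k : ℕ) :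
    Ideal.Quotient.mk I a ^ k = 1 ↔ a ^ k - 1 ∈ I := by
  rw [← map_pow, ← map_one (Ideal.Quotient.mk I), Ideal.Quotient.mk_eq_mk_iff_sub_mem]

theorem inf_mem_finitePIdeals {I J : Ideal (R p)} (hI : I ∈ finitePIdeals p)
    (hJ : J ∈ finitePIdeals p) : I ⊓ J ∈ finitePIdeals p := by
  refine ⟨inf_mem_finiteIdeals hI.1 hJ.1, fun g => ?_⟩
  obtain ⟨a, ha⟩ := hI.2 g
  obtain ⟨b, hb⟩ := hJ.2 g
  refine ⟨a + b, (mk_pow_eq_one_iff _ _ _).2 ⟨?_, ?_⟩⟩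
  · exact (mk_pow_eq_one_iff _ _ _).1 (by rw [pow_add, pow_mul, ha, one_pow])
  · exact (mk_pow_eq_one_iff _ _ _).1 (by rw [add_comm, pow_add, pow_mul, hb, one_pow])

theorem top_mem_finitePIdeals : ⊤ ∈ finitePIdeals p :=
  ⟨inferInstanceAs (Finite (R p ⧸ (⊤ : Ideal (R p)))),
    fun _ => ⟨0, (mk_pow_eq_one_iff _ _ _).2 trivial⟩⟩

theorem exists_single_sub_one_mem {I : Ideal (R p)} (hI : I ∈ finiteIdeals p) :
    ∃ m : ℕ+, AddMonoidAlgebra.single ((m : ℕ) : ℤ) 1 - 1 ∈ I := by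
  have : Finite (R p ⧸ I) := hI
  let x : R p := AddMonoidAlgebra.single 1 1
  have hx : IsUnit (Ideal.Quotient.mk I x) := by
    refine IsUnit.map _ (IsUnit.of_mul_eq_one (AddMonoidAlgebra.single (-1) 1) ?_)
    rw [AddMonoidAlgebra.single_mul_single]
    rw [add_neg_cancel, one_mul]
    rfl
  obtain ⟨u, hu⟩ := hx
  refine ⟨⟨Nat.card (R p ⧸ I)ˣ, Nat.card_pos⟩, ?_⟩
  have h : Ideal.Quotient.mk I x ^ Nat.card (R p ⧸ I)ˣ = 1 := by
    rw [← hu, ← Units.val_pow_eq_pow_val, pow_card_eq_one', Units.val_one]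
  rw [mk_pow_eq_one_iff, AddMonoidAlgebra.single_pow] at h
  simpa using h

theorem exists_ringEquiv_completedGroupRing [NeZero p] {ι : Type} [Nonempty ι] (μ : ι → ℕ)
    [∀ i, NeZero (μ i)] (hμ : ∀ i j, ∃ k, μ i ∣ μ k ∧ μ j ∣ μ k) {F : Set (Ideal (R p))}
    (hfin : F ⊆ finiteIdeals p) (hF : ∀ I ∈ F, ∀ J ∈ F, I ⊓ J ∈ F) (htop : ⊤ ∈ F)
    (hle : ∀ I ∈ F, ∃ i, AddMonoidAlgebra.single (μ i : ℤ) 1 - 1 ∈ I)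
    (hker : ∀ i, RingHom.ker (levelRingHom p (μ i)) ∈ F) :
    ∃ e : IdealCompletion F ≃+* CompletedGroupRing p μ, IsHomeomorph e ∧
      ∀ r, e (toIdealCompletion F r) = toCompletedGroupRing p μ r := by
  have : ∀ I : F, Finite (R p ⧸ I.1) := fun I => hfin I.2
  have := (isProjLimit_idealCompletion hF).compactSpace
  have := (isProjLimit_idealCompletion hF).t2Space
  have := (isProjLimit_completedGroupRing p hμ).compactSpace
  have := (isProjLimit_completedGroupRing p hμ).t2Space
  refine exists_isHomeomorph_ringEquiv _ _ (denseRange_toIdealCompletion hF htop)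
    (denseRange_toCompletedGroupRing p hμ) ?_
  refine (comap_toIdealCompletion_hasBasis hF htop).ext
    (comap_toCompletedGroupRing_hasBasis p hμ) (fun I hI => ?_) (fun i _ => ?_)
  · obtain ⟨i, hi⟩ := hle I hI
    exact ⟨i, trivial, ker_levelRingHom_le p _ I hi⟩
  · exact ⟨_, hker i, le_rfl⟩

end Rings

section Groups

variable (p n : ℕ)

/-- The homomorphism `ℒ_n → 𝔽_p[ℤ/m]^n ⋊ ℤ/m`. -/
noncomputable def levelHom (m : ℕ) :
    L p n →* Multiplicative (Fin n → AddMonoidAlgebra (ZMod p) (ZMod m))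
      ⋊[scalarAction n (AddMonoidAlgebra.of (ZMod p) (ZMod m))] Multiplicative (ZMod m) :=
  semidirectMap (AddMonoidAlgebra.of (ZMod p) (ZMod m)) (levelRingHom p m)
    (Int.castAddHom (ZMod m)) (fun s => (levelRingHom_single p m s 1).symm)

variable {p n}

theorem mem_ker_levelHom {m : ℕ} {g : L p n} : g ∈ (levelHom p n m).ker ↔
    (∀ k, levelRingHom p m (baseToRing p n g.left.toAdd k) = 0) ∧
      ((g.right.toAdd : ℤ) : ZMod m) = 0 := by
  rw [MonoidHom.mem_ker, SemidirectProduct.ext_iff]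
  exact and_congr_left fun _ => funext_iff

theorem index_ker_levelHom_dvd [NeZero p] (m : ℕ) [NeZero m] :
    (levelHom p n m).ker.index ∣ p ^ (m * n) * m := by
  have hcard : Nat.card (AddMonoidAlgebra (ZMod p) (ZMod m)) = p ^ m := by
    rw [Nat.card_congr AddMonoidAlgebra.coeffEquiv, Nat.card_congr Finsupp.equivFunOnFinite,
      Nat.card_fun, Nat.card_zmod, Nat.card_zmod]
  rw [Subgroup.index_ker]
  refine (Subgroup.card_subgroup_dvd_card _).trans (dvd_of_eq ?_)
  rw [SemidirectProduct.card, Nat.card_congr Multiplicative.toAdd,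
    Nat.card_congr Multiplicative.toAdd, Nat.card_fun, hcard, Nat.card_zmod, pow_mul, Nat.card_fin]

theorem coeff_levelRingHom_baseToRing (m : ℕ) (v : Base p n) (k : Fin n) (z : ZMod m) :
    (levelRingHom p m (baseToRing p n v k)).coeff z = v.mapDomain (Int.cast : ℤ → ZMod m) z k := by
  induction v using Finsupp.induction_linear with
  | zero => simp
  | add u₁ u₂ h₁ h₂ =>
    rw [map_add, Pi.add_apply, map_add, AddMonoidAlgebra.coeff_add, Finsupp.add_apply, h₁, h₂,
      Finsupp.mapDomain_add]
    rfl
  | single a w =>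
    have : baseToRing p n (Finsupp.single a w) k = AddMonoidAlgebra.single a (w k) :=
      congrArg AddMonoidAlgebra.ofCoeff Finsupp.mapRange_single
    rw [this, levelRingHom_single, Finsupp.mapDomain_single]
    change Finsupp.single (a : ZMod m) (w k) z = _
    rw [Finsupp.single_apply, Finsupp.single_apply]
    split_ifs <;> rfl

theorem mapDomain_intCast_eq_zero {m : ℕ} {v : Base p n}
    (hv : ∀ k, levelRingHom p m (baseToRing p n v k) = 0) :
    v.mapDomain (Int.cast : ℤ → ZMod m) = 0 := by
  ext z k
  rw [← coeff_levelRingHom_baseToRing, hv k]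
  rfl

theorem ker_levelHom_le (N : Subgroup (L p n)) [N.Normal] :
    (levelHom p n N.index).ker ≤ N := by
  intro g hg
  obtain ⟨hl, hr⟩ := mem_ker_levelHom.1 hg
  have hpow : SemidirectProduct.inr (Multiplicative.ofAdd (N.index : ℤ)) ∈ N := by
    have := Subgroup.pow_index_mem N
      (SemidirectProduct.inr (φ := shift p n) (Multiplicative.ofAdd (1 : ℤ)))
    rw [← map_pow, ← ofAdd_nsmul] at this
    simpa using this
  rw [← SemidirectProduct.inl_left_mul_inr_right g]
  refine N.mul_mem ?_ ?_
  · refine mem_of_mapDomain_intCast_eq_zero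
      (Subgroup.toAddSubgroup' (N.comap SemidirectProduct.inl)) N.index (fun a w => ?_)
      g.left.toAdd (mapDomain_intCast_eq_zero hl)
    change SemidirectProduct.inl (Multiplicative.ofAdd
      (Finsupp.single a w - Finsupp.single (N.index + a) w)) ∈ N
    have h : Multiplicative.ofAdd (Finsupp.single ((N.index : ℤ) + a) w) =
        shift p n (Multiplicative.ofAdd (N.index : ℤ))
          (Multiplicative.ofAdd (Finsupp.single a w)) := by
      change _ = Multiplicative.ofAdd (Finsupp.domCongr _ _)
      simp [add_comm]
    rw [ofAdd_sub, h, map_div, SemidirectProduct.inl_aut, map_inv, div_eq_mul_inv, mul_inv_rev,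
      mul_inv_rev, inv_inv, ← mul_assoc, ← mul_assoc]
    exact N.mul_mem (Subgroup.Normal.conj_mem ‹_› _ hpow _) (N.inv_mem hpow)
  · obtain ⟨q, hq⟩ := (ZMod.intCast_zmod_eq_zero_iff_dvd _ _).1 hr
    have : g.right = Multiplicative.ofAdd (N.index : ℤ) ^ q := by
      rw [← ofAdd_zsmul, smul_eq_mul, mul_comm, ← hq]
      rfl
    rw [this, map_zpow]
    exact N.zpow_mem hpow q

end Groups

/-! ### The topology of `A^n ⋊ T` -/

section Semidirect

/-- The semidirect product is homeomorphic to the product. -/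
def semidirectHomeomorph {N G : Type*} [Group N] [Group G] [TopologicalSpace N]
    [TopologicalSpace G] (φ : G →* MulAut N) : N ⋊[φ] G ≃ₜ N × G :=
  SemidirectProduct.equivProd.toHomeomorphOfIsInducing ⟨rfl⟩

variable {n : ℕ} {A T : Type} [CommRing A] [AddCommGroup T] [TopologicalSpace A]
  [TopologicalSpace T] [IsTopologicalRing A] [IsTopologicalAddGroup T]

theorem isTopologicalGroup_semidirect {γ : Multiplicative T →* A} (hγ : Continuous γ) :
    IsTopologicalGroup (Multiplicative (Fin n → A) ⋊[scalarAction n γ] Multiplicative T) := by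
  let h := semidirectHomeomorph (scalarAction n γ)
  have hl : Continuous fun g : Multiplicative (Fin n → A) ⋊[scalarAction n γ] Multiplicative T =>
      g.left := continuous_fst.comp h.continuous
  have hr : Continuous fun g : Multiplicative (Fin n → A) ⋊[scalarAction n γ] Multiplicative T =>
      g.right := continuous_snd.comp h.continuous
  have hcoord : ∀ k, Continuous
      fun g : Multiplicative (Fin n → A) ⋊[scalarAction n γ] Multiplicative T =>
        g.left.toAdd k := fun k =>
    (continuous_apply k).comp (continuous_toAdd.comp hl)
  refine { continuous_mul := ?_, continuous_inv := ?_ }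
  · refine continuous_induced_rng.2 (Continuous.prodMk ?_ ?_)
    · refine continuous_ofAdd.comp (continuous_pi fun k => ?_)
      exact ((hcoord k).comp continuous_fst).add
        ((hγ.comp (hr.comp continuous_fst)).mul ((hcoord k).comp continuous_snd))
    · exact (hr.comp continuous_fst).mul (hr.comp continuous_snd)
  · refine continuous_induced_rng.2 (Continuous.prodMk ?_ ?_)
    · refine continuous_ofAdd.comp (continuous_pi fun k => ?_)
      exact (hγ.comp hr.inv).mul (hcoord k).neg
    · exact hr.inv

variable {p : ℕ}

theorem baseToRing_surjective : Function.Surjective (baseToRing p n) := by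
  intro r
  have hfin : (Function.support fun (i : ℤ) (k : Fin n) => (r k).coeff i).Finite := by
    refine (Set.finite_iUnion fun k => (r k).coeff.hasFiniteSupport).subset fun i hi => ?_
    obtain ⟨k, hk⟩ := Function.ne_iff.1 hi
    exact Set.mem_iUnion.2 ⟨k, hk⟩
  refine ⟨Finsupp.ofSupportFinite _ hfin, funext fun k => ?_⟩
  ext i
  rfl

omit [IsTopologicalRing A] [IsTopologicalAddGroup T] in
theorem denseRange_semidirectMap {γ : Multiplicative T →* A} {θ : R p →+* A} {τ : ℤ →+ T}
    (h : ∀ s : ℤ, γ (Multiplicative.ofAdd (τ s)) = θ (AddMonoidAlgebra.single s 1))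
    (hθ : DenseRange θ) (hτ : DenseRange τ) :
    DenseRange (semidirectMap (n := n) γ θ τ h) := by
  have h1 : DenseRange (Pi.map (fun _ => θ) ∘ baseToRing p n) := by
    rw [DenseRange, baseToRing_surjective.range_comp]
    exact DenseRange.piMap fun _ => hθ
  let e := semidirectHomeomorph (scalarAction n γ)
  have h2 : DenseRange (e ∘ semidirectMap (n := n) γ θ τ h) :=
    (h1.prodMap hτ).mono (by
      rintro _ ⟨⟨v, s⟩, rfl⟩
      exact ⟨⟨Multiplicative.ofAdd v, Multiplicative.ofAdd s⟩, rfl⟩)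
  have h3 := e.symm.surjective.denseRange.comp h2 e.symm.continuous
  rwa [← Function.comp_assoc, e.symm_comp_self, Function.id_comp] at h3

end Semidirect

section Levels

variable {p n : ℕ} {ι : Type} {μ : ι → ℕ} {T : Type} [AddCommGroup T] [TopologicalSpace T]
  [IsTopologicalAddGroup T] {π : ∀ i, T →+ ZMod (μ i)} [Nonempty ι]

theorem continuous_groupLike (hμ : ∀ i j, ∃ k, μ i ∣ μ k ∧ μ j ∣ μ k)
    (hπ : ∀ (i j : ι) (h : μ i ∣ μ j) (t : T), ZMod.castHom h (ZMod (μ i)) (π j t) = π i t)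
    (hT : (𝓝 (0 : T)).HasBasis (fun _ : ι => True) (fun i => {t | π i t = 0})) :
    Continuous (groupLike p π hπ) := by
  refine continuous_iff_continuousAt.2 fun t =>
    ((isProjLimit_completedGroupRing p hμ).nhds_hasBasis _).tendsto_right_iff.2 fun i _ => ?_
  have h : Tendsto (fun s : Multiplicative T => s.toAdd - t.toAdd) (𝓝 t) (𝓝 0) := by
    have : Continuous fun s : Multiplicative T => s.toAdd - t.toAdd :=
      continuous_toAdd.sub continuous_const
    simpa using this.tendsto t
  filter_upwards [h (hT.mem_of_mem (i := i) trivial)] with s hs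
  have : π i s.toAdd = π i t.toAdd := by
    rw [← sub_eq_zero, ← map_sub]
    exact hs
  change AddMonoidAlgebra.single (π i s.toAdd) 1 = AddMonoidAlgebra.single (π i t.toAdd) 1
  rw [this]

omit [IsTopologicalAddGroup T] in
theorem comap_semidirectMap_hasBasis (hμ : ∀ i j, ∃ k, μ i ∣ μ k ∧ μ j ∣ μ k)
    {hπ : ∀ (i j : ι) (h : μ i ∣ μ j) (t : T), ZMod.castHom h (ZMod (μ i)) (π j t) = π i t}
    (hT : (𝓝 (0 : T)).HasBasis (fun _ : ι => True) (fun i => {t | π i t = 0}))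
    {τ : ℤ →+ T} (hτ : ∀ i k, π i (τ k) = k)
    (h : ∀ s : ℤ, groupLike p π hπ (Multiplicative.ofAdd (τ s)) =
      toCompletedGroupRing p μ (AddMonoidAlgebra.single s 1)) :
    (comap (semidirectMap (n := n) (groupLike p π hπ) (toCompletedGroupRing p μ) τ h)
      (𝓝 1)).HasBasis (fun _ : ι => True) (fun i => ((levelHom p n (μ i)).ker : Set (L p n))) := by
  have hA := (isProjLimit_completedGroupRing p hμ).nhds_hasBasis 0
  have hAn : (𝓝 (0 : Fin n → CompletedGroupRing p μ)).HasBasis (fun _ : ι => True)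
      (fun i => {a | ∀ k, (a k).1 i = 0}) := by
    rw [nhds_pi]
    refine hA.pi_self.to_hasBasis (fun Ik _ => ⟨Ik.2, trivial, fun a ha k _ => ha k⟩)
      (fun i _ => ⟨⟨Set.univ, i⟩, ⟨Set.finite_univ, trivial⟩, fun a ha k => ha k trivial⟩)
  have hprod := hAn.prod_same_index hT (fun {i j} _ _ => by
    obtain ⟨k, hi, hj⟩ := hμ i j
    refine ⟨k, trivial, fun a ha c => ?_, fun t ht => ?_⟩
    · rw [← (a c).2 i k hi, show (a c).1 k = 0 from ha c, map_zero]
    · change π j t = 0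
      rw [← hπ j k hj, show π k t = 0 from ht, map_zero])
  rw [← nhds_prod_eq] at hprod
  let e := semidirectHomeomorph (scalarAction n (groupLike p π hπ))
  have he : 𝓝 1 = comap e (𝓝 (e 1)) := e.isInducing.nhds_eq_comap 1
  rw [he, comap_comap]
  have hbasis := hprod.comap
    (e ∘ semidirectMap (n := n) (groupLike p π hπ) (toCompletedGroupRing p μ) τ h)
  refine hbasis.congr (fun _ => Iff.rfl) fun i _ => ?_
  ext g
  refine Iff.trans ?_ mem_ker_levelHom.symm
  rw [← hτ i]
  exact Iff.rfl

theorem exists_mulEquiv_semidirect [Fact p.Prime] [∀ i, NeZero (μ i)]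
    [CompactSpace T] [T2Space T] (hμ : ∀ i j, ∃ k, μ i ∣ μ k ∧ μ j ∣ μ k)
    {hπ : ∀ (i j : ι) (h : μ i ∣ μ j) (t : T), ZMod.castHom h (ZMod (μ i)) (π j t) = π i t}
    (hT : (𝓝 (0 : T)).HasBasis (fun _ : ι => True) (fun i => {t | π i t = 0}))
    {τ : ℤ →+ T} (hτ : ∀ i k, π i (τ k) = k) (hdense : DenseRange τ)
    (h : ∀ s : ℤ, groupLike p π hπ (Multiplicative.ofAdd (τ s)) =
      toCompletedGroupRing p μ (AddMonoidAlgebra.single s 1))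
    {C : Type} [Group C] [TopologicalSpace C] [IsTopologicalGroup C] [CompactSpace C] [T2Space C]
    {c : L p n →* C} (hc : DenseRange c) {S : Subgroup (L p n) → Prop}
    (hS : (comap c (𝓝 1)).HasBasis S (fun N => (N : Set (L p n))))
    (hle : ∀ N, S N → N.Normal ∧ ∃ i, μ i = N.index)
    (hker : ∀ (N : Subgroup (L p n)) i a, N.Normal → N.index ∣ p ^ a * μ i → S N) :
    ∃ e : C ≃ₜ* Multiplicative (Fin n → CompletedGroupRing p μ)
        ⋊[scalarAction n (groupLike p π hπ)] Multiplicative T,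
      ∀ g, e (c g) = semidirectMap (groupLike p π hπ) (toCompletedGroupRing p μ) τ h g := by
  have := (isProjLimit_completedGroupRing p hμ).compactSpace
  have := (isProjLimit_completedGroupRing p hμ).t2Space
  let e := semidirectHomeomorph (scalarAction n (groupLike p π hπ))
  have := e.symm.compactSpace
  have : T2Space (Multiplicative T) := ‹T2Space T›
  have : T2Space (Multiplicative (Fin n → CompletedGroupRing p μ)) :=
    inferInstanceAs (T2Space (Fin n → CompletedGroupRing p μ))
  have := e.symm.t2Space
  have := isTopologicalGroup_semidirect (n := n) (continuous_groupLike (p := p) hμ hπ hT)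
  refine exists_continuousMulEquiv _ _ hc
    (denseRange_semidirectMap h (denseRange_toCompletedGroupRing p hμ) hdense) ?_
  refine hS.ext (comap_semidirectMap_hasBasis hμ hT hτ h) (fun N hN => ?_) (fun i _ => ?_)
  · obtain ⟨hn, i, hi⟩ := hle N hN
    exact ⟨i, trivial, hi ▸ ker_levelHom_le N⟩
  · exact ⟨_, hker _ i _ inferInstance (index_ker_levelHom_dvd (μ i)), le_rfl⟩

omit [Nonempty ι] in
theorem exists_mulEquiv_int [∀ i, NeZero (μ i)] [CompactSpace T] [T2Space T]
    (hT : (𝓝 (0 : T)).HasBasis (fun _ : ι => True) (fun i => {t | π i t = 0}))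
    {τ : ℤ →+ T} (hτ : ∀ i k, π i (τ k) = k) (hdense : DenseRange τ)
    {C : Type} [Group C] [TopologicalSpace C] [IsTopologicalGroup C] [CompactSpace C] [T2Space C]
    {c : Multiplicative ℤ →* C} (hc : DenseRange c) {S : Subgroup (Multiplicative ℤ) → Prop}
    (hS : (comap c (𝓝 1)).HasBasis S (fun N => (N : Set (Multiplicative ℤ))))
    (hle : ∀ N, S N → ∃ i, μ i = N.index)
    (hker : ∀ (N : Subgroup (Multiplicative ℤ)) i, N.index ∣ μ i → S N) :
    ∃ e : C ≃ₜ* Multiplicative T,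
      ∀ k : ℤ, e (c (Multiplicative.ofAdd k)) = Multiplicative.ofAdd (τ k) := by
  have : T2Space (Multiplicative T) := ‹T2Space T›
  suffices h : comap c (𝓝 1) = comap (AddMonoidHom.toMultiplicative τ) (𝓝 1) by
    obtain ⟨e, he⟩ := exists_continuousMulEquiv c (AddMonoidHom.toMultiplicative τ) hc hdense h
    exact ⟨e, fun k => he _⟩
  have hbasis : (comap (AddMonoidHom.toMultiplicative τ) (𝓝 1)).HasBasis (fun _ : ι => True)
      (fun i => {k : Multiplicative ℤ | ((k.toAdd : ℤ) : ZMod (μ i)) = 0}) := by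
    refine (hT.comap τ).congr (fun _ => Iff.rfl) fun i _ => ?_
    ext k
    change π i (τ k) = 0 ↔ _
    rw [hτ]
    rfl
  refine hS.ext hbasis (fun N hN => ?_) (fun i _ => ?_)
  · obtain ⟨i, hi⟩ := hle N hN
    refine ⟨i, trivial, fun k hk => ?_⟩
    obtain ⟨q, hq⟩ := (ZMod.intCast_zmod_eq_zero_iff_dvd _ _).1 hk
    have : k = (Multiplicative.ofAdd q) ^ N.index := by
      rw [← ofAdd_nsmul, nsmul_eq_mul, ← hi]
      exact hq
    rw [this]
    exact Subgroup.pow_index_mem N _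
  · let f : Multiplicative ℤ →* Multiplicative (ZMod (μ i)) :=
      AddMonoidHom.toMultiplicative (Int.castAddHom (ZMod (μ i)))
    refine ⟨f.ker, hker _ i ?_, fun k hk => hk⟩
    rw [Subgroup.index_ker]
    refine (Subgroup.card_subgroup_dvd_card _).trans (dvd_of_eq ?_)
    rw [Nat.card_congr Multiplicative.toAdd, Nat.card_zmod]

end Levels

/-! ### The completions of `ℒ_n`, `ℤ` and `R` -/

theorem exists_equiv_proPCompletion (p : ℕ) [Fact p.Prime] (n : ℕ) :
    (∃ e : ProPCompletion p (L p n) ≃ₜ*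
          ProPTarget p n,
        ∀ g, e (toProPCompletion p _ g) =
          toProPTarget p n g) ∧
    (∃ e : ProPCompletion p (Multiplicative ℤ) ≃ₜ* Multiplicative ℤ_[p],
        ∀ k : ℤ, e (toProPCompletion p _ (Multiplicative.ofAdd k)) =
          Multiplicative.ofAdd (k : ℤ_[p])) ∧
    (∃ e : IdealCompletion (finitePIdeals p) ≃+*
          FpZp p,
        IsHomeomorph e ∧
        ∀ r, e (toIdealCompletion _ r) =
          toCompletedGroupRing p _ r) := by
  have hμ : ∀ i j : ℕ, ∃ k, p ^ i ∣ p ^ k ∧ p ^ j ∣ p ^ k := fun i j =>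
    ⟨i + j, pow_dvd_pow p (Nat.le_add_right i j), pow_dvd_pow p (Nat.le_add_left j i)⟩
  have hτ : ∀ (m : ℕ) (k : ℤ), (PadicInt.toZModPow m : ℤ_[p] →+* ZMod (p ^ m)).toAddMonoidHom
      (Int.castAddHom ℤ_[p] k) = k := fun m k => map_intCast (PadicInt.toZModPow m) k
  have := compactSpace_proPCompletion (G := L p n) p
  have := (isProjLimit_proPCompletion (G := L p n) p).t2Space
  have := compactSpace_proPCompletion (G := Multiplicative ℤ) p
  have := (isProjLimit_proPCompletion (G := Multiplicative ℤ) p).t2Space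
  refine ⟨?_, ?_, ?_⟩
  · refine exists_mulEquiv_semidirect (μ := fun m : ℕ => p ^ m) hμ (nhds_padicInt_hasBasis p) hτ
      PadicInt.denseRange_intCast _ (denseRange_toProPCompletion (L p n) p)
      (comap_toProPCompletion_hasBasis (L p n) p) (fun N hN => ⟨hN.1, ?_⟩) (fun N i a hN h => ?_)
    · obtain ⟨k, hk⟩ := hN.2
      exact ⟨k, hk.symm⟩
    · rw [← pow_add] at h
      obtain ⟨k, -, hk⟩ := (Nat.dvd_prime_pow Fact.out).1 h
      exact ⟨hN, k, hk⟩
  · refine exists_mulEquiv_int (μ := fun m : ℕ => p ^ m) (nhds_padicInt_hasBasis p) hτ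
      PadicInt.denseRange_intCast (denseRange_toProPCompletion _ p)
      (comap_toProPCompletion_hasBasis _ p) (fun N hN => ?_) (fun N i h => ?_)
    · obtain ⟨k, hk⟩ := hN.2
      exact ⟨k, hk.symm⟩
    · obtain ⟨k, -, hk⟩ := (Nat.dvd_prime_pow Fact.out).1 h
      exact ⟨inferInstance, k, hk⟩
  · refine exists_ringEquiv_completedGroupRing _ hμ (fun I hI => hI.1)
      (fun I hI J hJ => inf_mem_finitePIdeals hI hJ) top_mem_finitePIdeals (fun I hI => ?_)
      (fun i => ⟨finite_quotient_ker_levelRingHom _, fun g => ⟨i, ?_⟩⟩)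
    · obtain ⟨k, hk⟩ := hI.2 1
      refine ⟨k, ?_⟩
      rw [mk_pow_eq_one_iff, AddMonoidAlgebra.single_pow] at hk
      simpa using hk
    · exact (mk_pow_eq_one_iff _ _ _).2 (single_sub_one_mem_ker p (p ^ i) g)

theorem exists_equiv_profiniteCompletion (p : ℕ) [Fact p.Prime] (n : ℕ) :
    (∃ e : ProfiniteGrp.ProfiniteCompletion.completion
            (GrpCat.of (L p n)) ≃ₜ*
          ProfiniteTarget p n,
        ∀ g, e (ProfiniteGrp.ProfiniteCompletion.etaFn
            (GrpCat.of (L p n)) g) =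
          toProfiniteTarget p n g) ∧
    (∃ e : ProfiniteGrp.ProfiniteCompletion.completion (GrpCat.of (Multiplicative ℤ)) ≃ₜ*
          Multiplicative ZHat,
        ∀ k : ℤ, e (ProfiniteGrp.ProfiniteCompletion.etaFn (GrpCat.of (Multiplicative ℤ))
            (Multiplicative.ofAdd k)) =
          Multiplicative.ofAdd (intToZHat k)) ∧
    (∃ e : IdealCompletion (finiteIdeals p) ≃+*
          FpZHat p,
        IsHomeomorph e ∧
        ∀ r, e (toIdealCompletion _ r) =
          toCompletedGroupRing p _ r) := by
  have hτ : ∀ (m : ℕ+) (k : ℤ), ZHat.proj m (intToZHat k) = k := fun _ _ => rfl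
  refine ⟨?_, ?_, ?_⟩
  · refine exists_mulEquiv_semidirect (μ := fun m : ℕ+ => (m : ℕ)) directed_pnat
      nhds_zHat_hasBasis hτ denseRange_intToZHat _
      (c := toProfiniteCompletion (L p n)) (ProfiniteGrp.ProfiniteCompletion.denseRange _)
      (comap_toProfiniteCompletion_hasBasis (L p n))
      (fun N hN => ⟨hN.1, ⟨N.index, Nat.pos_of_ne_zero hN.2⟩, rfl⟩) (fun N i a hN h => ⟨hN, ?_⟩)
    exact ne_zero_of_dvd_ne_zero
      (mul_ne_zero (pow_ne_zero _ (Fact.out : p.Prime).ne_zero) i.ne_zero) h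
  · exact exists_mulEquiv_int (μ := fun m : ℕ+ => (m : ℕ)) nhds_zHat_hasBasis hτ
      denseRange_intToZHat (c := toProfiniteCompletion (Multiplicative ℤ))
      (ProfiniteGrp.ProfiniteCompletion.denseRange _)
      (comap_toProfiniteCompletion_hasBasis _)
      (fun N hN => ⟨⟨N.index, Nat.pos_of_ne_zero hN.2⟩, rfl⟩)
      (fun N i h => ⟨inferInstance, ne_zero_of_dvd_ne_zero i.ne_zero h⟩)
  · exact exists_ringEquiv_completedGroupRing _ directed_pnat le_rfl
      (fun I hI J hJ => inf_mem_finiteIdeals hI hJ) top_mem_finitePIdeals.1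
      (fun I hI => exists_single_sub_one_mem hI)
      (fun i => finite_quotient_ker_levelRingHom _)

end LamplighterCompletion

theorem lemma3p19 (p : ℕ) [Fact p.Prime] (n : ℕ) :
    -- `𝔽_p[[ℤ_p]]^n ⋊ ℤ_p` is the pro-`p` completion of `ℒ_n`
    (∃ e : LamplighterCompletion.ProPCompletion p (LamplighterCompletion.L p n) ≃ₜ*
          LamplighterCompletion.ProPTarget p n,
        ∀ g, e (LamplighterCompletion.toProPCompletion p _ g) =
          LamplighterCompletion.toProPTarget p n g) ∧
    -- `ℤ_p` is the pro-`p` completion of `ℤ`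
    (∃ e : LamplighterCompletion.ProPCompletion p (Multiplicative ℤ) ≃ₜ* Multiplicative ℤ_[p],
        ∀ k : ℤ, e (LamplighterCompletion.toProPCompletion p _ (Multiplicative.ofAdd k)) =
          Multiplicative.ofAdd (k : ℤ_[p])) ∧
    -- `𝔽_p[[ℤ_p]]` is the pro-`p` completion of the group ring `R = 𝔽_p[ℤ]`
    (∃ e : LamplighterCompletion.IdealCompletion (LamplighterCompletion.finitePIdeals p) ≃+*
          LamplighterCompletion.FpZp p,
        IsHomeomorph e ∧
        ∀ r, e (LamplighterCompletion.toIdealCompletion _ r) =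
          LamplighterCompletion.toCompletedGroupRing p _ r) ∧
    -- `𝔽_p[[ẑ]]^n ⋊ ẑ` is the profinite completion of `ℒ_n`
    (∃ e : ProfiniteGrp.ProfiniteCompletion.completion
            (GrpCat.of (LamplighterCompletion.L p n)) ≃ₜ*
          LamplighterCompletion.ProfiniteTarget p n,
        ∀ g, e (ProfiniteGrp.ProfiniteCompletion.etaFn
            (GrpCat.of (LamplighterCompletion.L p n)) g) =
          LamplighterCompletion.toProfiniteTarget p n g) ∧
    -- `ẑ = lim ℤ/m` is the profinite completion of `ℤ`
    (∃ e : ProfiniteGrp.ProfiniteCompletion.completion (GrpCat.of (Multiplicative ℤ)) ≃ₜ*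
          Multiplicative LamplighterCompletion.ZHat,
        ∀ k : ℤ, e (ProfiniteGrp.ProfiniteCompletion.etaFn (GrpCat.of (Multiplicative ℤ))
            (Multiplicative.ofAdd k)) =
          Multiplicative.ofAdd (LamplighterCompletion.intToZHat k)) ∧
    -- `𝔽_p[[ẑ]]` is the profinite completion of the ring `R = 𝔽_p[ℤ]`
    (∃ e : LamplighterCompletion.IdealCompletion (LamplighterCompletion.finiteIdeals p) ≃+*
          LamplighterCompletion.FpZHat p,
        IsHomeomorph e ∧
        ∀ r, e (LamplighterCompletion.toIdealCompletion _ r) =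
          LamplighterCompletion.toCompletedGroupRing p _ r) := by
  obtain ⟨h₁, h₂, h₃⟩ := LamplighterCompletion.exists_equiv_proPCompletion p n
  obtain ⟨h₄, h₅, h₆⟩ := LamplighterCompletion.exists_equiv_profiniteCompletion p n
  exact ⟨h₁, h₂, h₃, h₄, h₅, h₆⟩
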